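/- Let $E$ be a complex Banach space, let $M\ge 1$ and $\omega\ge 0$, and put $\Lambda_\omega=\{\lambda\in\mathbb{C} : \operatorname{Re}\lambda>\omega\}$. For a linear operator $A:D(A)\subset E\to E$ let $\rho(A)$ be the set of all $\lambda\in\mathbb{C}$ for which $\lambda I-A:D(A)\to E$ is bijective, and for $\lambda\in\rho(A)$ write $R(\lambda;A)=(\lambda I-A)^{-1}$. Let $\mathcal{GI}(M,\omega)$ denote the set of all infinitesimal generators $A$ of $C_0$-semigroups of bounded linear operators on $E$ such that $\Lambda_\omega\subset\rho(A)$ and $$\|R(\lambda;A)^m\|\le \frac{M}{(\operatorname{Re}\lambda-\omega)^m}\qquad\text{for all }\lambda\in\Lambda_\omega,\ m\ge 1 .$$ **Theorem (Trotter–Kato).** For each $n\ge 1$ let $\{T_n(t)\}_{t\ge 0}$ be a $C_0$-semigroup on $E$ with $\|T_n(t)\|\le Me^{\omega t}$ for all $t\ge 0$, and let $A_n$ be its infinitesimal generator (so that $A_n\in\mathcal{GI}(M,\omega)$). Suppose that for some $\lambda_0\in\Lambda_\omega$ there is a bounded linear operator $R_{\lambda_0}$ on $E$ such that $R(\lambda_0;A_n)x\to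 R_{\lambda_0}x$ as $n\to\infty$ for every $x\in E$, and that the range of $R_{\lambda_0}$ is dense in $E$. Then for every $\lambda\in\Lambda_\omega$ the sequence $(R(\lambda;A_n))_n$ converges strongly to a bounded linear operator $R_\lambda$ on $E$, and there is a unique operator $A\in\mathcal{GI}(M,\omega)$ such that $R_\lambda=R(\lambda;A)$ for all $\lambda\in\Lambda_\omega$. Moreover, if $\{T(t)\}_{t\ge 0}$ is the $C_0$-semigroup generated by $A$, then for every $t_0>0$ and every $x\in E$, $$\lim_{n\to\infty}\ \sup_{t\in[0,t_0]}\|T_n(t)x-T(t)x\|=0 .$$ -/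

import Mathlib

open Filter Topology

noncomputable section

variable {E : Type*} [NormedAddCommGroup E] [NormedSpace ℂ E]

/-- A family `T(t)`, `t ≥ 0`, of bounded linear operators on `E` is a `C₀`-semigroup.
The family is given as a function on `ℝ`; its values at `t < 0` play no role anywhere. -/
structure IsC0Semigroup (T : ℝ → E →L[ℂ] E) : Prop where
  map_zero : T 0 = ContinuousLinearMap.id ℂ E
  map_add : ∀ t s : ℝ, 0 ≤ t → 0 ≤ s → T (t + s) = (T t).comp (T s)
  tendsto_zero : ∀ x : E, Tendsto (fun t : ℝ => T t x) (𝓝[>] 0) (𝓝 x)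

/-- The class `SG(M, ω)`: `C₀`-semigroups with `‖T(t)‖ ≤ M e^{ω t}` for all `t ≥ 0`. -/
structure IsC0SemigroupOfType (M ω : ℝ) (T : ℝ → E →L[ℂ] E) : Prop where
  isC0Semigroup : IsC0Semigroup T
  norm_le : ∀ t : ℝ, 0 ≤ t → ‖T t‖ ≤ M * Real.exp (ω * t)

/-- `A` (a linear operator defined on a subspace `A.domain` of `E`) is the infinitesimal generator
of the family `T`: its domain is the set of all `x` for which `(T(t)x - x) / t` has a limit
as `t ↘ 0`, and `A x` is that limit. -/
structure IsInfinitesimalGenerator (A : E →ₗ.[ℂ] E) (T : ℝ → E →L[ℂ] E) : Prop where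
  mem_domain_iff : ∀ x : E, x ∈ A.domain ↔
    ∃ y : E, Tendsto (fun t : ℝ => t⁻¹ • (T t x - x)) (𝓝[>] 0) (𝓝 y)
  tendsto_apply : ∀ x : A.domain,
    Tendsto (fun t : ℝ => t⁻¹ • (T t (x : E) - (x : E))) (𝓝[>] 0) (𝓝 (A x))

/-- The resolvent set `ρ(A)`: all `z ∈ ℂ` such that `z I - A : D(A) → E` is bijective. -/
def LinearPMap.resolventSet (A : E →ₗ.[ℂ] E) : Set ℂ :=
  {z : ℂ | Function.Bijective (fun x : A.domain => z • (x : E) - A x)}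

/-- The bounded operator `R` is a two-sided inverse of `z I - A : D(A) → E`. -/
structure LinearPMap.IsResolventAt (A : E →ₗ.[ℂ] E) (z : ℂ) (R : E →L[ℂ] E) : Prop where
  left_inv : ∀ x : A.domain, R (z • (x : E) - A x) = (x : E)
  right_inv : ∀ y : E, ∃ x : A.domain, R y = (x : E) ∧ z • (x : E) - A x = y

theorem LinearPMap.IsResolventAt.unique {A : E →ₗ.[ℂ] E} {z : ℂ} {R S : E →L[ℂ] E}
    (hR : A.IsResolventAt z R) (hS : A.IsResolventAt z S) : R = S := by
  ext y
  obtain ⟨x, hx, hy⟩ := hR.right_inv y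
  rw [hx, ← hy, hS.left_inv]

open Classical in
/-- The resolvent `R(z; A) = (z I - A)⁻¹`, as a bounded operator on `E` (and `0` if there is no
bounded inverse; for closed `A` and `z ∈ ρ(A)` there is one, see
`LinearPMap.isResolventAt_resolventOp`). -/
def LinearPMap.resolventOp (A : E →ₗ.[ℂ] E) (z : ℂ) : E →L[ℂ] E :=
  if h : ∃ R : E →L[ℂ] E, A.IsResolventAt z R then h.choose else 0

theorem LinearPMap.IsResolventAt.resolventOp_eq {A : E →ₗ.[ℂ] E} {z : ℂ} {R : E →L[ℂ] E}
    (hR : A.IsResolventAt z R) : A.resolventOp z = R := by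
  have h : ∃ R : E →L[ℂ] E, A.IsResolventAt z R := ⟨R, hR⟩
  rw [LinearPMap.resolventOp, dif_pos h]
  exact h.choose_spec.unique hR

/-- For a closed operator on a Banach space, the inverse of `z I - A` at a point of the resolvent
set is bounded (closed graph theorem), so `resolventOp` is that inverse. -/
theorem LinearPMap.isResolventAt_resolventOp [CompleteSpace E] {A : E →ₗ.[ℂ] E} (hA : A.IsClosed)
    {z : ℂ} (hz : z ∈ A.resolventSet) : A.IsResolventAt z (A.resolventOp z) := by
  let f : A.domain →ₗ[ℂ] E := z • A.domain.subtype - A.toFun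
  have hf : ∀ x : A.domain, f x = z • (x : E) - A x := fun x => rfl
  have hb : Function.Bijective f := hz
  let e : A.domain ≃ₗ[ℂ] E := LinearEquiv.ofBijective f hb
  let g : E →ₗ[ℂ] E := A.domain.subtype.comp e.symm.toLinearMap
  have hg : ∀ y, g y = (e.symm y : E) := fun y => rfl
  have he : ∀ y, z • (e.symm y : E) - A (e.symm y) = y := fun y => e.apply_symm_apply y
  have hgr : (g.graph : Set (E × E)) =
      (fun p : E × E => (p.2, z • p.2 - p.1)) ⁻¹' (A.graph : Set (E × E)) := by
    ext ⟨y, x⟩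
    simp only [SetLike.mem_coe, LinearMap.mem_graph_iff, Set.mem_preimage,
      LinearPMap.mem_graph_iff]
    constructor
    · intro h
      refine ⟨e.symm y, by rw [h, hg], ?_⟩
      rw [h, hg, eq_sub_iff_add_eq, ← eq_sub_iff_add_eq', he]
    · rintro ⟨w, hw, hAw⟩
      have : e w = y := by
        change z • (w : E) - A w = y
        rw [hAw, hw]; abel
      rw [← this, hg, e.symm_apply_apply, hw]
  have hc : _root_.IsClosed (g.graph : Set (E × E)) := by
    rw [hgr]
    exact _root_.IsClosed.preimage (by fun_prop) hA
  have hR : A.IsResolventAt z (ContinuousLinearMap.ofIsClosedGraph hc) := by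
    refine ⟨fun x => ?_, fun y => ⟨e.symm y, rfl, he y⟩⟩
    change ((e.symm (e x) : A.domain) : E) = x
    rw [e.symm_apply_apply]
  rw [hR.resolventOp_eq]
  exact hR

/-- The class `GI(M, ω)`: infinitesimal generators `A` of `C₀`-semigroups on `E` such that
every `z` with `Re z > ω` lies in `ρ(A)` and `‖R(z; A)ⁿ‖ ≤ M / (Re z - ω)ⁿ` for all `n ≥ 1`. -/
structure IsGeneratorOfType (M ω : ℝ) (A : E →ₗ.[ℂ] E) : Prop where
  exists_semigroup : ∃ T : ℝ → E →L[ℂ] E, IsC0Semigroup T ∧ IsInfinitesimalGenerator A T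
  mem_resolventSet : ∀ z : ℂ, ω < z.re → z ∈ A.resolventSet
  norm_resolventOp_pow_le : ∀ z : ℂ, ω < z.re → ∀ n : ℕ, 1 ≤ n →
    ‖A.resolventOp z ^ n‖ ≤ M / (z.re - ω) ^ n

end

/-! The resolvent of a generator is the Laplace transform of its semigroup; conversely, implicit
Euler steps recover the semigroup from the resolvent, T(t) = lim (I - (t/k)A)^{-k}. On D(A²) the
error is O(‖A²x‖/k) with a constant depending only on M, ω and t (`exponential_formula`), hence
uniform in n along the sequence T_n.

Convergence at z₀ spreads over the half plane: the Neumann series around w converges on a disc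
reaching the line Re = ω, with a majorant independent of n, and the half plane is connected
(`exists_tendsto_laplace`). For fixed k the Euler products therefore converge strongly. The vectors
R(z₀; A_n)²w lie in D(A_n²), have bounded images under A_n² and tend to R₀²w; as R₀² has dense
range, T_n(t)x is Cauchy for every x (`cauchySeq_semigroup_apply`).

The limit S is a semigroup of the same type, and equi-Lipschitz orbits make the convergence uniform
on bounded intervals. Dominated convergence of the Laplace transforms identifies the limits of the
resolvents with the resolvents of the generator of S. An operator is determined by one resolvent,
which gives uniqueness. -/

noncomputable section

open MeasureTheory Set

/-! ### Generators, continuity of orbits and exponential growth -/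

section Semigroup

variable {E : Type*} [NormedAddCommGroup E] [NormedSpace ℂ E]

/-- The pair `(x, y)` lies in the graph of the infinitesimal generator of `T`. -/
def GenPair (T : ℝ → E →L[ℂ] E) (x y : E) : Prop :=
  Tendsto (fun t : ℝ => t⁻¹ • (T t x - x)) (𝓝[>] 0) (𝓝 y)

theorem GenPair.unique {T : ℝ → E →L[ℂ] E} {x y y' : E} (h : GenPair T x y)
    (h' : GenPair T x y') : y = y' :=
  tendsto_nhds_unique h h'

theorem GenPair.add {T : ℝ → E →L[ℂ] E} {x y x' y' : E} (h : GenPair T x y)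
    (h' : GenPair T x' y') : GenPair T (x + x') (y + y') := by
  refine (Tendsto.add h h').congr fun t => ?_
  rw [← smul_add, map_add]
  congr 1
  abel

theorem GenPair.smul {T : ℝ → E →L[ℂ] E} {x y : E} (c : ℂ) (h : GenPair T x y) :
    GenPair T (c • x) (c • y) := by
  refine (Tendsto.const_smul h c).congr fun t => ?_
  rw [map_smul, ← smul_sub, smul_comm]

theorem GenPair.zero (T : ℝ → E →L[ℂ] E) : GenPair T 0 0 := by
  simp [GenPair]

theorem GenPair.map_of_commute {T : ℝ → E →L[ℂ] E} {x y : E} (h : GenPair T x y)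
    {L : E →L[ℂ] E} (hL : ∀ t, 0 ≤ t → ∀ v, T t (L v) = L (T t v)) : GenPair T (L x) (L y) := by
  refine ((L.continuous.tendsto y).comp h).congr' ?_
  filter_upwards [self_mem_nhdsWithin] with t ht
  simp only [Function.comp_apply]
  rw [hL t (le_of_lt ht), ← map_sub]
  exact (L.restrictScalars ℝ).map_smul _ _

theorem mem_graph_iff_genPair {A : E →ₗ.[ℂ] E} {T : ℝ → E →L[ℂ] E}
    (hA : IsInfinitesimalGenerator A T) {x y : E} : (x, y) ∈ A.graph ↔ GenPair T x y := by
  rw [LinearPMap.mem_graph_iff]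
  constructor
  · rintro ⟨w, rfl, rfl⟩
    exact hA.tendsto_apply w
  · intro h
    exact ⟨⟨x, (hA.mem_domain_iff x).2 ⟨y, h⟩⟩, rfl,
      tendsto_nhds_unique (hA.tendsto_apply _) h⟩

/-- Every family of operators has an infinitesimal generator. -/
theorem exists_isInfinitesimalGenerator (T : ℝ → E →L[ℂ] E) :
    ∃ A : E →ₗ.[ℂ] E, IsInfinitesimalGenerator A T := by
  let G : Submodule ℂ (E × E) :=
    { carrier := {p | GenPair T p.1 p.2}
      add_mem' := fun h h' => GenPair.add h h'
      zero_mem' := GenPair.zero T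
      smul_mem' := fun c _ h => GenPair.smul c h }
  have hG : ∀ p ∈ G, p.1 = 0 → p.2 = 0 := by
    rintro ⟨x, y⟩ h rfl
    exact GenPair.unique h (GenPair.zero T)
  have hgr : ∀ x y, (x, y) ∈ G.toLinearPMap.graph ↔ GenPair T x y := by
    intro x y
    rw [Submodule.toLinearPMap_graph_eq G hG]
    rfl
  refine ⟨G.toLinearPMap, fun x => ?_, fun x => (hgr _ _).1 (LinearPMap.mem_graph _ x)⟩
  constructor
  · intro hx
    exact ⟨_, (hgr _ _).1 (LinearPMap.mem_graph _ ⟨x, hx⟩)⟩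
  · rintro ⟨y, hy⟩
    exact LinearPMap.mem_domain_of_mem_graph ((hgr _ _).2 hy)

theorem IsC0Semigroup.map_add_apply {T : ℝ → E →L[ℂ] E} (hT : IsC0Semigroup T) {t s : ℝ}
    (ht : 0 ≤ t) (hs : 0 ≤ s) (x : E) : T (t + s) x = T t (T s x) := by
  rw [hT.map_add t s ht hs]; rfl

theorem IsC0Semigroup.commute {T : ℝ → E →L[ℂ] E} (hT : IsC0Semigroup T) {t s : ℝ}
    (ht : 0 ≤ t) (hs : 0 ≤ s) (x : E) : T t (T s x) = T s (T t x) := by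
  rw [← map_add_apply hT ht hs, add_comm, map_add_apply hT hs ht]

theorem IsC0Semigroup.map_nat_mul {T : ℝ → E →L[ℂ] E} (hT : IsC0Semigroup T) {t : ℝ}
    (ht : 0 ≤ t) (k : ℕ) : T (k * t) = T t ^ k := by
  induction k with
  | zero => simp [hT.map_zero, ContinuousLinearMap.one_def]
  | succ k ih =>
    rw [Nat.cast_succ, add_mul, one_mul, hT.map_add _ _ (by positivity) ht, ih, pow_succ]
    rfl

section type

variable {M ω : ℝ} {T : ℝ → E →L[ℂ] E}

theorem IsC0SemigroupOfType.nonneg (hT : IsC0SemigroupOfType M ω T) : 0 ≤ M := by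
  simpa using (norm_nonneg _).trans (hT.norm_le 0 le_rfl)

theorem IsC0SemigroupOfType.norm_apply_le (hT : IsC0SemigroupOfType M ω T) {t : ℝ} (ht : 0 ≤ t)
    (x : E) : ‖T t x‖ ≤ M * Real.exp (ω * t) * ‖x‖ :=
  (T t).le_of_opNorm_le (hT.norm_le t ht) x

theorem IsC0SemigroupOfType.mono (hT : IsC0SemigroupOfType M ω T) {M' ω' : ℝ} (hM : M ≤ M')
    (hω : ω ≤ ω') : IsC0SemigroupOfType M' ω' T := by
  refine ⟨hT.1, fun t ht => (hT.norm_le t ht).trans ?_⟩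
  have hM' : 0 ≤ M' := (nonneg hT).trans hM
  gcongr

/-- Factor out T(min t s). The form symmetric in s and t yields left and right continuity from
continuity at 0 by a single squeeze. -/
theorem IsC0SemigroupOfType.norm_apply_sub_le (hT : IsC0SemigroupOfType M ω T) {s t : ℝ}
    (hs : 0 ≤ s) (ht : 0 ≤ t) (x : E) :
    ‖T t x - T s x‖ ≤ M * Real.exp (ω * min t s) * ‖T |t - s| x - x‖ := by
  wlog hst : s ≤ t generalizing s t
  · rw [norm_sub_rev, min_comm, abs_sub_comm]
    exact this ht hs (le_of_not_ge hst)
  rw [min_eq_right hst, abs_of_nonneg (sub_nonneg.2 hst)]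
  have : T t x - T s x = T s (T (t - s) x - x) := by
    rw [map_sub, ← IsC0Semigroup.map_add_apply hT.1 hs (sub_nonneg.2 hst)]
    congr 3
    ring
  rw [this]
  exact norm_apply_le hT hs _

theorem IsC0SemigroupOfType.continuousOn (hT : IsC0SemigroupOfType M ω T) (x : E) :
    ContinuousOn (fun t => T t x) (Ici 0) := by
  intro s hs
  have h0 : Tendsto (fun r : ℝ => ‖T r x - x‖) (𝓝[≥] 0) (𝓝 0) := by
    rw [← Ioi_insert, nhdsWithin_insert, tendsto_sup]
    constructor
    · rw [tendsto_pure_left]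
      intro U hU
      simpa [hT.1.map_zero] using mem_of_mem_nhds hU
    · simpa using ((hT.1.tendsto_zero x).sub_const x).norm
  have habs' : Tendsto (fun t => |t - s|) (𝓝[Ici 0] s) (𝓝[≥] 0) := by
    refine tendsto_nhdsWithin_iff.2 ⟨?_, Eventually.of_forall fun t => Set.mem_Ici.2 (abs_nonneg _)⟩
    refine Tendsto.mono_left ?_ nhdsWithin_le_nhds
    have : Continuous fun t : ℝ => |t - s| := by fun_prop
    simpa using this.tendsto s
  have hb : Tendsto (fun t => M * Real.exp (ω * min t s) * ‖T |t - s| x - x‖)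
      (𝓝[Ici 0] s) (𝓝 0) := by
    have h1 : Tendsto (fun t => M * Real.exp (ω * min t s)) (𝓝[Ici 0] s)
        (𝓝 (M * Real.exp (ω * min s s))) := by
      refine Tendsto.mono_left ?_ nhdsWithin_le_nhds
      exact Continuous.tendsto (by fun_prop) s
    simpa using h1.mul (h0.comp habs')
  refine tendsto_iff_norm_sub_tendsto_zero.2 (squeeze_zero' ?_ ?_ hb)
  · exact Eventually.of_forall fun t => norm_nonneg _
  · filter_upwards [self_mem_nhdsWithin] with t ht
    exact norm_apply_sub_le hT hs ht x

theorem IsC0Semigroup.hasDerivWithinAt {T : ℝ → E →L[ℂ] E} (hT : IsC0Semigroup T) {x y : E}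
    (h : GenPair T x y) {s : ℝ} (hs : 0 ≤ s) :
    HasDerivWithinAt (fun t => T t x) (T s y) (Ici s) s := by
  rw [← hasDerivWithinAt_Ioi_iff_Ici, hasDerivWithinAt_iff_tendsto_slope' (by simp)]
  have hsub : Tendsto (fun t => t - s) (𝓝[>] s) (𝓝[>] 0) := by
    refine tendsto_nhdsWithin_iff.2 ⟨?_, ?_⟩
    · refine Tendsto.mono_left ?_ nhdsWithin_le_nhds
      have : Continuous fun t : ℝ => t - s := by fun_prop
      simpa using this.tendsto s
    · filter_upwards [self_mem_nhdsWithin] with t ht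
      exact sub_pos.2 (Set.mem_Ioi.1 ht)
  refine (((T s).continuous.tendsto y).comp (h.comp hsub)).congr' ?_
  filter_upwards [self_mem_nhdsWithin] with t ht
  have ht' : 0 ≤ t - s := le_of_lt (sub_pos.2 (Set.mem_Ioi.1 ht))
  have : T t x = T s (T (t - s) x) := by
    rw [← map_add_apply hT hs ht']
    congr 2
    ring
  simp only [Function.comp_apply, slope, vsub_eq_sub]
  rw [this, ← map_sub]
  exact ((T s).restrictScalars ℝ).map_smul _ _

end type

/-- Every `C₀`-semigroup on a Banach space is exponentially bounded. -/
theorem IsC0Semigroup.exists_type [CompleteSpace E] {T : ℝ → E →L[ℂ] E} (hT : IsC0Semigroup T) :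
    ∃ M ω : ℝ, 0 ≤ ω ∧ IsC0SemigroupOfType M ω T := by
  have hloc : ∃ δ > 0, ∃ C, ∀ t ∈ Icc (0 : ℝ) δ, ‖T t‖ ≤ C := by
    by_contra! hcon
    -- The summand ‖T 0‖ forces t n ≠ 0: strong continuity is assumed only along t ↘ 0 with t > 0.
    -- The uniform boundedness principle then contradicts ‖T (t n)‖ > n.
    have hex : ∀ n : ℕ, ∃ t ∈ Icc (0 : ℝ) (1 / ((n : ℝ) + 1)), (n : ℝ) + ‖T 0‖ < ‖T t‖ :=
      fun n => hcon _ (by positivity) _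
    choose t ht htn using hex
    have hpos : ∀ n, 0 < t n := by
      intro n
      refine lt_of_le_of_ne (ht n).1 fun h => ?_
      have := htn n
      rw [← h] at this
      have : (0 : ℝ) ≤ n := Nat.cast_nonneg n
      linarith
    have hlim : Tendsto t atTop (𝓝[>] 0) := by
      refine tendsto_nhdsWithin_iff.2 ⟨?_, Eventually.of_forall hpos⟩
      exact squeeze_zero (fun n => (ht n).1) (fun n => (ht n).2)
        tendsto_one_div_add_atTop_nhds_zero_nat
    obtain ⟨C, hC⟩ := banach_steinhaus (g := fun n => T (t n)) (fun x => by
      obtain ⟨C, hC⟩ := (((hT.tendsto_zero x).comp hlim).norm).bddAbove_range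
      exact ⟨C, fun n => hC ⟨n, rfl⟩⟩)
    obtain ⟨n, hn⟩ := exists_nat_gt C
    have h1 := hC n
    have h2 := htn n
    have h3 := norm_nonneg (T 0)
    linarith
  obtain ⟨δ, hδ, C, hC⟩ := hloc
  set K := max C 1 with hK
  have hK1 : 1 ≤ K := le_max_right _ _
  have hKC : ∀ t ∈ Icc (0 : ℝ) δ, ‖T t‖ ≤ K := fun t ht => (hC t ht).trans (le_max_left _ _)
  -- The rate is chosen so that K^(t/δ) = exp(ωt); one further factor K covers the remainder of t
  -- modulo δ.
  refine ⟨K, Real.log K / δ, div_nonneg (Real.log_nonneg hK1) hδ.le, hT, fun t ht => ?_⟩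
  set n := ⌊t / δ⌋₊ with hn
  have hnt : (n : ℝ) * δ ≤ t := by
    rw [← le_div_iff₀ hδ]
    exact Nat.floor_le (by positivity)
  have htn : t - n * δ ≤ δ := by
    have := (Nat.lt_floor_add_one (t / δ)).le
    rw [div_le_iff₀ hδ] at this
    linarith
  have hsplit : T t = (T (t - n * δ)).comp (T δ ^ n) := by
    rw [← map_nat_mul hT hδ.le, ← hT.map_add _ _ (by linarith) (by positivity)]
    congr 1
    ring
  have hpow : ‖T δ ^ n‖ ≤ K ^ n := by
    rcases Nat.eq_zero_or_pos n with h | h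
    · rw [h, pow_zero, pow_zero]
      exact ContinuousLinearMap.norm_id_le.trans le_rfl
    · exact (norm_pow_le' _ h).trans
        (pow_le_pow_left₀ (norm_nonneg _) (hKC δ ⟨hδ.le, le_rfl⟩) _)
  rw [hsplit]
  refine (ContinuousLinearMap.opNorm_comp_le _ _).trans ?_
  have hexp : K ^ n ≤ Real.exp (Real.log K / δ * t) := by
    rw [← Real.exp_log (show 0 < K by linarith), ← Real.exp_nat_mul, Real.log_exp]
    apply Real.exp_le_exp.2
    rw [div_mul_eq_mul_div, le_div_iff₀ hδ]
    nlinarith [Real.log_nonneg hK1]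
  exact mul_le_mul (hKC _ ⟨by linarith, htn⟩) (hpow.trans hexp) (norm_nonneg _) (by linarith)

end Semigroup

/-! ### The resolvent as Laplace transform, and its power bounds -/

section Laplace

variable {E : Type*} [NormedAddCommGroup E] [NormedSpace ℂ E]
variable {M ω : ℝ} {T : ℝ → E →L[ℂ] E} {z : ℂ}

theorem integral_exp_sub_mul_Ioi {a ω : ℝ} (h : ω < a) :
    ∫ t in Ioi (0 : ℝ), Real.exp ((ω - a) * t) = (a - ω)⁻¹ := by
  rw [integral_exp_mul_Ioi (by linarith)]
  simp only [mul_zero, Real.exp_zero]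
  rw [neg_div, ← div_neg, neg_sub, one_div]

theorem IsC0SemigroupOfType.continuousOn_exp_smul (hT : IsC0SemigroupOfType M ω T) (z : ℂ)
    (x : E) : ContinuousOn (fun t : ℝ => Complex.exp (-(z * t)) • T t x) (Ici 0) :=
  ContinuousOn.smul (by fun_prop) (hT.continuousOn x)

theorem norm_exp_neg_smul_le {C : ℝ} {v : E} {t : ℝ} (h : ‖v‖ ≤ C * Real.exp (ω * t)) (z : ℂ) :
    ‖Complex.exp (-(z * t)) • v‖ ≤ C * Real.exp ((ω - z.re) * t) := by
  rw [norm_smul, Complex.norm_exp]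
  have : (-(z * (t : ℂ))).re = -(z.re * t) := by simp
  rw [this]
  calc Real.exp (-(z.re * t)) * ‖v‖ ≤ Real.exp (-(z.re * t)) * (C * Real.exp (ω * t)) := by gcongr
    _ = C * Real.exp ((ω - z.re) * t) := by
      rw [mul_left_comm, ← Real.exp_add]
      congr 2
      ring

theorem IsC0SemigroupOfType.norm_exp_smul_le (hT : IsC0SemigroupOfType M ω T) (z : ℂ)
    {t : ℝ} (ht : 0 ≤ t) (x : E) :
    ‖Complex.exp (-(z * t)) • T t x‖ ≤ M * ‖x‖ * Real.exp ((ω - z.re) * t) :=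
  norm_exp_neg_smul_le ((hT.norm_apply_le ht x).trans_eq (by ring)) z

theorem IsC0SemigroupOfType.integrableOn (hT : IsC0SemigroupOfType M ω T) (hz : ω < z.re)
    (x : E) : IntegrableOn (fun t : ℝ => Complex.exp (-(z * t)) • T t x) (Ioi 0) := by
  refine Integrable.mono' ((integrableOn_exp_mul_Ioi (a := ω - z.re) (by linarith) 0).const_mul
    (M * ‖x‖)) ?_ ?_
  · exact ((hT.continuousOn_exp_smul z x).mono Ioi_subset_Ici_self).aestronglyMeasurable
      measurableSet_Ioi
  · filter_upwards [ae_restrict_mem measurableSet_Ioi] with t ht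
    exact hT.norm_exp_smul_le z (le_of_lt ht) x

/-- The Laplace transform `x ↦ ∫₀^∞ e^{-zt} T(t) x dt` of a `C₀`-semigroup. -/
def IsC0SemigroupOfType.laplace (hT : IsC0SemigroupOfType M ω T) (hz : ω < z.re) : E →L[ℂ] E :=
  LinearMap.mkContinuous
    { toFun := fun x => ∫ t in Ioi (0 : ℝ), Complex.exp (-(z * t)) • T t x
      map_add' := fun x y => by
        simp only [map_add, smul_add]
        exact integral_add (hT.integrableOn hz x) (hT.integrableOn hz y)
      map_smul' := fun c x => by
        simp only [map_smul, RingHom.id_apply]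
        rw [← integral_smul]
        exact integral_congr_ae (Eventually.of_forall fun t => smul_comm _ _ _) }
    (M * (z.re - ω)⁻¹) fun x => by
      refine (norm_integral_le_of_norm_le ((integrableOn_exp_mul_Ioi (a := ω - z.re)
        (by linarith) 0).const_mul (M * ‖x‖)) ?_).trans_eq ?_
      · filter_upwards [ae_restrict_mem measurableSet_Ioi] with t ht
        exact hT.norm_exp_smul_le z (le_of_lt ht) x
      · rw [integral_const_mul, integral_exp_sub_mul_Ioi hz]
        ring

theorem IsC0SemigroupOfType.laplace_apply (hT : IsC0SemigroupOfType M ω T) (hz : ω < z.re)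
    (x : E) : hT.laplace hz x = ∫ t in Ioi (0 : ℝ), Complex.exp (-(z * t)) • T t x := rfl

theorem LinearPMap.IsResolventAt.mem_resolventSet {A : E →ₗ.[ℂ] E} {R : E →L[ℂ] E}
    (hR : A.IsResolventAt z R) : z ∈ A.resolventSet := by
  refine ⟨fun x y hxy => ?_, fun y => ?_⟩
  · have : R (z • (x : E) - A x) = R (z • (y : E) - A y) := congrArg R hxy
    rw [hR.left_inv, hR.left_inv] at this
    exact Subtype.ext this
  · obtain ⟨x, -, hx⟩ := hR.right_inv y
    exact ⟨x, hx⟩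

/-- A single resolvent operator encodes the whole graph; closedness of A and its determination by
one resolvent follow. -/
theorem LinearPMap.IsResolventAt.mem_graph_iff {A : E →ₗ.[ℂ] E} {R : E →L[ℂ] E}
    (hR : A.IsResolventAt z R) {x y : E} : (x, y) ∈ A.graph ↔ R (z • x - y) = x := by
  rw [LinearPMap.mem_graph_iff]
  constructor
  · rintro ⟨w, rfl, rfl⟩
    exact hR.left_inv w
  · intro h
    obtain ⟨w, hw, hAw⟩ := hR.right_inv (z • x - y)
    rw [h] at hw
    refine ⟨w, hw.symm, ?_⟩
    rw [← hw] at hAw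
    exact sub_right_injective hAw

theorem LinearPMap.IsResolventAt.isClosed {A : E →ₗ.[ℂ] E} {R : E →L[ℂ] E}
    (hR : A.IsResolventAt z R) : A.IsClosed := by
  have : (A.graph : Set (E × E)) = {p | R (z • p.1 - p.2) = p.1} := by
    ext ⟨x, y⟩
    exact hR.mem_graph_iff
  rw [LinearPMap.IsClosed, this]
  exact isClosed_eq (by fun_prop) (by fun_prop)

theorem LinearPMap.IsResolventAt.ext {A B : E →ₗ.[ℂ] E} {R : E →L[ℂ] E}
    (hA : A.IsResolventAt z R) (hB : B.IsResolventAt z R) : A = B := by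
  refine LinearPMap.eq_of_eq_graph (SetLike.ext fun p => ?_)
  exact hA.mem_graph_iff.trans hB.mem_graph_iff.symm

variable [CompleteSpace E]

theorem IsC0SemigroupOfType.apply_laplace (hT : IsC0SemigroupOfType M ω T) (hz : ω < z.re)
    {s : ℝ} (hs : 0 ≤ s) (x : E) :
    T s (hT.laplace hz x) = ∫ t in Ioi (0 : ℝ), Complex.exp (-(z * t)) • T (s + t) x := by
  rw [hT.laplace_apply, ← ContinuousLinearMap.integral_comp_comm _ (hT.integrableOn hz x)]
  refine setIntegral_congr_fun measurableSet_Ioi fun t ht => ?_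
  simp only [map_smul]
  rw [hT.1.map_add_apply hs (le_of_lt ht)]

theorem IsC0SemigroupOfType.laplace_commute (hT : IsC0SemigroupOfType M ω T) (hz : ω < z.re)
    {s : ℝ} (hs : 0 ≤ s) (x : E) : T s (hT.laplace hz x) = hT.laplace hz (T s x) := by
  rw [hT.apply_laplace hz hs, hT.laplace_apply]
  refine setIntegral_congr_fun measurableSet_Ioi fun t ht => ?_
  rw [hT.1.map_add_apply hs (le_of_lt ht), hT.1.commute hs (le_of_lt ht)]

/-- The bound is on the whole orbit of y, so it reproduces itself with C replaced by C / (Re z - ω).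
Iteration then costs the factor M only once, instead of M^m. -/
theorem IsC0SemigroupOfType.norm_apply_laplace_le (hT : IsC0SemigroupOfType M ω T)
    (hz : ω < z.re) {C : ℝ} {y : E} (hy : ∀ t, 0 ≤ t → ‖T t y‖ ≤ C * Real.exp (ω * t))
    {s : ℝ} (hs : 0 ≤ s) :
    ‖T s (hT.laplace hz y)‖ ≤ C * (z.re - ω)⁻¹ * Real.exp (ω * s) := by
  rw [hT.apply_laplace hz hs]
  refine (norm_integral_le_of_norm_le ((integrableOn_exp_mul_Ioi (a := ω - z.re)
    (by linarith) 0).const_mul (C * Real.exp (ω * s))) ?_).trans_eq ?_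
  · filter_upwards [ae_restrict_mem measurableSet_Ioi] with t ht
    have ht : 0 < t := ht
    refine norm_exp_neg_smul_le ((hy (s + t) (by linarith)).trans_eq ?_) z
    rw [mul_assoc, ← Real.exp_add]
    congr 2
    ring
  · rw [integral_const_mul, integral_exp_sub_mul_Ioi hz]
    ring

theorem IsC0SemigroupOfType.norm_laplace_pow_le (hT : IsC0SemigroupOfType M ω T)
    (hz : ω < z.re) (m : ℕ) : ‖hT.laplace hz ^ m‖ ≤ M / (z.re - ω) ^ m := by
  have hpos : 0 < z.re - ω := by linarith
  have key : ∀ (x : E) (m : ℕ) (s : ℝ), 0 ≤ s →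
      ‖T s ((hT.laplace hz ^ m) x)‖ ≤ M * ‖x‖ * ((z.re - ω)⁻¹) ^ m * Real.exp (ω * s) := by
    intro x m
    induction m with
    | zero =>
      intro s hs
      simpa [mul_right_comm] using hT.norm_apply_le hs x
    | succ m ih =>
      intro s hs
      rw [pow_succ', mul_apply_eq_comp]
      refine (hT.norm_apply_laplace_le hz ih hs).trans_eq ?_
      ring
  have := hT.nonneg
  refine ContinuousLinearMap.opNorm_le_bound _ (by positivity) fun x => ?_
  have h := key x m 0 le_rfl
  rw [hT.1.map_zero] at h
  simp only [ContinuousLinearMap.id_apply, mul_zero, Real.exp_zero, mul_one] at h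
  refine h.trans_eq ?_
  rw [inv_pow, div_eq_mul_inv]
  ring

/-- Substitution gives T(h)Ly = e^{zh}(Ly - ∫₀^h e^{-zu}T(u)y du), where L is the Laplace transform;
differentiate at h = 0. -/
theorem IsC0SemigroupOfType.genPair_laplace (hT : IsC0SemigroupOfType M ω T) (hz : ω < z.re)
    (y : E) : GenPair T (hT.laplace hz y) (z • hT.laplace hz y - y) := by
  -- Truncating at `max u 0` makes the integrand continuous on all of ℝ, since T is arbitrary at
  -- negative times; the fundamental theorem then applies at 0.
  set g : ℝ → E := fun u => Complex.exp (-(z * u)) • T (max u 0) y with hg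
  have hgc : Continuous g := by
    refine Continuous.smul (by fun_prop) ?_
    exact (hT.continuousOn y).comp_continuous (by fun_prop) fun u => Set.mem_Ici.2 (le_max_right _ _)
  have hgT : ∀ u, 0 ≤ u → g u = Complex.exp (-(z * u)) • T u y := fun u hu => by
    simp only [hg, max_eq_left hu]
  have hgi : IntegrableOn g (Ioi 0) :=
    (hT.integrableOn hz y).congr_fun (fun u hu => (hgT u (le_of_lt hu)).symm) measurableSet_Ioi
  have hL : hT.laplace hz y = ∫ u in Ioi (0 : ℝ), g u :=
    setIntegral_congr_fun measurableSet_Ioi fun u hu => (hgT u (le_of_lt hu)).symm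
  have hshift : ∀ h : ℝ, 0 ≤ h → T h (hT.laplace hz y) =
      Complex.exp (z * h) • (hT.laplace hz y - ∫ u in (0 : ℝ)..h, g u) := by
    intro h hh
    have hsplit : (∫ u in (0 : ℝ)..h, g u) + ∫ u in Ioi h, g u = ∫ u in Ioi (0 : ℝ), g u :=
      intervalIntegral.integral_interval_add_Ioi hgi
        (hgi.mono_set (Ioi_subset_Ioi hh))
    have hsub : hT.laplace hz y - ∫ u in (0 : ℝ)..h, g u = ∫ u in Ioi h, g u := by
      rw [hL, ← hsplit, add_sub_cancel_left]
    rw [hsub, ← integral_smul, hT.apply_laplace hz hh]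
    have hpre := (measurePreserving_add_right volume h).setIntegral_preimage_emb
      (measurableEmbedding_addRight h) (fun u => Complex.exp (z * h) • g u) (Ioi h)
    have hset : (fun x : ℝ => x + h) ⁻¹' Ioi h = Ioi 0 := by
      ext x; simp
    rw [← hpre, hset]
    refine setIntegral_congr_fun measurableSet_Ioi fun t ht => ?_
    have ht : 0 < t := ht
    rw [hgT _ (by linarith), smul_smul, ← Complex.exp_add, add_comm t h]
    congr 2
    push_cast
    ring
  have hderiv : HasDerivAt (fun h : ℝ => Complex.exp (z * h) •
      (hT.laplace hz y - ∫ u in (0 : ℝ)..h, g u)) (z • hT.laplace hz y - y) 0 := by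
    have h1 : HasDerivAt (fun h : ℝ => Complex.exp (z * h)) z 0 := by
      have : HasDerivAt (fun w : ℂ => Complex.exp (z * w)) z ((0 : ℝ) : ℂ) := by
        have := ((hasDerivAt_id ((0 : ℝ) : ℂ)).const_mul z).cexp
        simpa using this
      exact this.comp_ofReal
    have h2 : HasDerivAt (fun h : ℝ => hT.laplace hz y - ∫ u in (0 : ℝ)..h, g u) (-y) 0 := by
      have := (hgc.integral_hasStrictDerivAt 0 0).hasDerivAt.const_sub (hT.laplace hz y)
      simpa [hg, hT.1.map_zero] using this
    have := h1.smul h2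
    simp only [Complex.ofReal_zero, mul_zero, Complex.exp_zero, one_smul,
      intervalIntegral.integral_same, sub_zero] at this
    rw [sub_eq_neg_add]
    exact this
  refine hderiv.tendsto_slope_zero_right.congr' ?_
  filter_upwards [self_mem_nhdsWithin] with t ht
  rw [zero_add, ← hshift t (le_of_lt ht)]
  simp

/-- L commutes with T(t), so the generator sends Lx to Ly; it also sends Lx to zLx - x. -/
theorem IsC0SemigroupOfType.laplace_of_genPair (hT : IsC0SemigroupOfType M ω T)
    (hz : ω < z.re) {x y : E} (h : GenPair T x y) : hT.laplace hz (z • x - y) = x := by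
  have h1 : GenPair T (hT.laplace hz x) (hT.laplace hz y) :=
    h.map_of_commute fun t ht v => hT.laplace_commute hz ht v
  have h2 := (hT.genPair_laplace hz x).unique h1
  rw [map_sub, map_smul, ← h2]
  abel

theorem IsC0SemigroupOfType.isResolventAt_laplace (hT : IsC0SemigroupOfType M ω T)
    (hz : ω < z.re) {A : E →ₗ.[ℂ] E} (hA : IsInfinitesimalGenerator A T) :
    A.IsResolventAt z (hT.laplace hz) := by
  refine ⟨fun x => hT.laplace_of_genPair hz (hA.tendsto_apply x), fun y => ?_⟩
  have := (mem_graph_iff_genPair hA).2 (hT.genPair_laplace hz y)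
  obtain ⟨w, hw, hAw⟩ := (LinearPMap.mem_graph_iff _).1 this
  exact ⟨w, hw.symm, by rw [hAw, hw]; simp⟩

/-- An operator of class `GI(M, ω)` is closed, so its resolvent operators are inverses. -/
theorem IsGeneratorOfType.isResolventAt {A : E →ₗ.[ℂ] E} (hA : IsGeneratorOfType M ω A)
    (hz : ω < z.re) : A.IsResolventAt z (A.resolventOp z) := by
  obtain ⟨T, hT, hAT⟩ := hA.exists_semigroup
  obtain ⟨M', ω', -, hT'⟩ := hT.exists_type
  -- The growth type (M', ω') of the semigroup may differ from (M, ω), but closedness needs just one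
  -- resolvent point.
  have hz' : ω' < ((ω' + 1 : ℝ) : ℂ).re := by simp
  exact LinearPMap.isResolventAt_resolventOp (hT'.isResolventAt_laplace hz' hAT).isClosed
    (hA.mem_resolventSet z hz)

theorem IsC0SemigroupOfType.isGeneratorOfType (hT : IsC0SemigroupOfType M ω T)
    {A : E →ₗ.[ℂ] E} (hA : IsInfinitesimalGenerator A T) : IsGeneratorOfType M ω A where
  exists_semigroup := ⟨T, hT.1, hA⟩
  mem_resolventSet z hz := (hT.isResolventAt_laplace hz hA).mem_resolventSet
  norm_resolventOp_pow_le z hz n _ := by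
    rw [(hT.isResolventAt_laplace hz hA).resolventOp_eq]
    exact hT.norm_laplace_pow_le hz n

end Laplace

/-! ### Implicit Euler approximation with a rate -/

section Euler

variable {E : Type*} [NormedAddCommGroup E] [NormedSpace ℂ E]
variable {M ω : ℝ} {T : ℝ → E →L[ℂ] E}

theorem IsC0SemigroupOfType.norm_sub_le_of_genPair (hT : IsC0SemigroupOfType M ω T)
    (hω : 0 ≤ ω) {x y : E} (h : GenPair T x y) {b s t : ℝ} (hs : 0 ≤ s) (hst : s ≤ t)
    (htb : t ≤ b) : ‖T t x - T s x‖ ≤ M * Real.exp (ω * b) * ‖y‖ * (t - s) := by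
  refine norm_image_sub_le_of_norm_deriv_right_le_segment (f := fun t => T t x)
    (f' := fun t => T t y) (a := s) (b := b)
    ((hT.continuousOn x).mono fun r hr => hs.trans hr.1)
    (fun r hr => hT.1.hasDerivWithinAt h (hs.trans hr.1)) (fun r hr => ?_) t ⟨hst, htb⟩
  refine (hT.norm_apply_le (hs.trans hr.1) y).trans ?_
  have := hT.nonneg
  have := hr.2.le
  gcongr

/-- Taylor estimate of second order: T(t)x - ty has right derivative T(t)y - y, which is O(t)
because y is in the domain. -/
theorem IsC0SemigroupOfType.norm_sub_sub_le_of_genPair (hT : IsC0SemigroupOfType M ω T)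
    (hω : 0 ≤ ω) {x y w : E} (h : GenPair T x y) (h' : GenPair T y w) {t : ℝ} (ht : 0 ≤ t) :
    ‖T t x - x - t • y‖ ≤ M * Real.exp (ω * t) * ‖w‖ * t * t := by
  have key := norm_image_sub_le_of_norm_deriv_right_le_segment (f := fun t => T t x - t • y)
    (f' := fun t => T t y - (1 : ℝ) • y) (C := M * Real.exp (ω * t) * ‖w‖ * t) (a := 0) (b := t)
    (((hT.continuousOn x).mono fun r hr => hr.1).sub (by fun_prop))
    (fun r hr => (hT.1.hasDerivWithinAt h hr.1).sub
      ((hasDerivWithinAt_id r _).smul_const y)) (fun r hr => ?_) t ⟨ht, le_rfl⟩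
  · simpa [hT.1.map_zero, sub_right_comm] using key
  · have h1 := hT.norm_sub_le_of_genPair hω h' le_rfl hr.1 hr.2.le
    rw [hT.1.map_zero, ContinuousLinearMap.id_apply, sub_zero] at h1
    rw [one_smul]
    refine h1.trans ?_
    have := hT.nonneg
    have := hr.2.le
    gcongr

theorem inv_one_sub_le_exp {u : ℝ} (h0 : 0 ≤ u) (h1 : 2 * u ≤ 1) :
    (1 - u)⁻¹ ≤ Real.exp (2 * u) := by
  rw [inv_le_iff_one_le_mul₀ (by linarith)]
  have := Real.add_one_le_exp (2 * u)
  nlinarith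

theorem lt_ofReal_inv_re {h : ℝ} (hh : 0 < h) (hu : 2 * (ω * h) ≤ 1) :
    ω < ((h⁻¹ : ℝ) : ℂ).re := by
  rw [Complex.ofReal_re, ← one_div, lt_div_iff₀ hh]
  linarith

variable [CompleteSpace E]

/-- The implicit Euler step `(I - hA)⁻¹ = h⁻¹ R(h⁻¹; A)`. -/
def IsC0SemigroupOfType.eulerStep (hT : IsC0SemigroupOfType M ω T) {h : ℝ}
    (hz : ω < ((h⁻¹ : ℝ) : ℂ).re) : E →L[ℂ] E :=
  ((h⁻¹ : ℝ) : ℂ) • hT.laplace hz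

section step

variable {h : ℝ} (hz : ω < ((h⁻¹ : ℝ) : ℂ).re)

/-- Stability: the resolvent power bounds give M(1 - ωh)^{-m}, with one factor M for every m. -/
theorem IsC0SemigroupOfType.norm_eulerStep_pow_le (hT : IsC0SemigroupOfType M ω T)
    (hh : 0 < h) (hω : 0 ≤ ω) (hu : 2 * (ω * h) ≤ 1) (m : ℕ) :
    ‖hT.eulerStep hz ^ m‖ ≤ M * Real.exp (2 * (ω * h)) ^ m := by
  have hM := hT.nonneg
  rw [eulerStep, smul_pow, norm_smul, norm_pow, Complex.norm_real, Real.norm_of_nonneg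
    (by positivity)]
  have hz' : 0 < h⁻¹ - ω := sub_pos.2 hz
  calc h⁻¹ ^ m * ‖hT.laplace hz ^ m‖ ≤ h⁻¹ ^ m * (M / (h⁻¹ - ω) ^ m) := by
        gcongr
        exact hT.norm_laplace_pow_le hz m
    _ = M * ((1 - ω * h)⁻¹) ^ m := by
        have : (1 - ω * h)⁻¹ = h⁻¹ * (h⁻¹ - ω)⁻¹ := by
          rw [← mul_inv]
          congr 1
          field_simp
        rw [this, mul_pow, inv_pow (h⁻¹ - ω)]
        ring
    _ ≤ M * Real.exp (2 * (ω * h)) ^ m := by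
        have : 0 ≤ (1 - ω * h)⁻¹ := inv_nonneg.2 (by linarith)
        gcongr
        exact inv_one_sub_le_exp (by positivity) hu

theorem IsC0SemigroupOfType.eulerStep_sub (hT : IsC0SemigroupOfType M ω T) (hh : 0 < h)
    {x y : E} (hxy : GenPair T x y) :
    hT.eulerStep hz x - x = h • hT.eulerStep hz y := by
  have h1 := hT.laplace_of_genPair hz hxy
  rw [map_sub, map_smul, sub_eq_iff_eq_add'] at h1
  simp only [eulerStep, smul_apply]
  rw [h1, ← Complex.coe_smul h, smul_smul, ← Complex.ofReal_mul, mul_inv_cancel₀ hh.ne']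
  simp

theorem IsC0SemigroupOfType.eulerStep_commute (hT : IsC0SemigroupOfType M ω T) {t : ℝ}
    (ht : 0 ≤ t) : Commute (T t) (hT.eulerStep hz) := by
  refine Commute.smul_right ?_ _
  exact ContinuousLinearMap.ext fun x => hT.laplace_commute hz ht x

/-- Consistency: T(h)x and the Euler step both equal x + hy up to O(h²). -/
theorem IsC0SemigroupOfType.norm_apply_sub_eulerStep_le (hT : IsC0SemigroupOfType M ω T)
    (hh : 0 < h) (hω : 0 ≤ ω) (hu : 2 * (ω * h) ≤ 1) {x y w : E} (hxy : GenPair T x y)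
    (hyw : GenPair T y w) :
    ‖(T h - hT.eulerStep hz) x‖ ≤ 2 * M * h ^ 2 * Real.exp (2 * (ω * h)) * ‖w‖ := by
  have hM := hT.nonneg
  have h1 := hT.norm_sub_sub_le_of_genPair hω hxy hyw hh.le
  have h2 : hT.eulerStep hz x - x - h • y = h • h • hT.eulerStep hz w := by
    rw [hT.eulerStep_sub hz hh hxy, ← smul_sub, hT.eulerStep_sub hz hh hyw]
  have h3 : ‖hT.eulerStep hz w‖ ≤ M * Real.exp (2 * (ω * h)) * ‖w‖ := by
    have := hT.norm_eulerStep_pow_le hz hh hω hu 1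
    rw [pow_one, pow_one] at this
    exact ContinuousLinearMap.le_of_opNorm_le _ this w
  have h4 : (T h - hT.eulerStep hz) x = (T h x - x - h • y) - h • h • hT.eulerStep hz w := by
    rw [← h2, sub_apply]
    abel
  have h5 : Real.exp (ω * h) ≤ Real.exp (2 * (ω * h)) := by
    have : 0 ≤ ω * h := by positivity
    exact Real.exp_le_exp.2 (by linarith)
  rw [h4]
  calc _ ≤ ‖T h x - x - h • y‖ + ‖h • h • hT.eulerStep hz w‖ := norm_sub_le _ _
    _ ≤ M * Real.exp (2 * (ω * h)) * ‖w‖ * h * h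
        + h * (h * (M * Real.exp (2 * (ω * h)) * ‖w‖)) := by
      rw [norm_smul, norm_smul, Real.norm_of_nonneg hh.le]
      refine add_le_add (h1.trans ?_) ?_
      · gcongr
      · gcongr
    _ = _ := by ring

theorem IsC0SemigroupOfType.norm_apply_sub_eulerStep_pow_le (hT : IsC0SemigroupOfType M ω T)
    (hh : 0 < h) (hω : 0 ≤ ω) (hu : 2 * (ω * h) ≤ 1) {x y w : E} (hxy : GenPair T x y)
    (hyw : GenPair T y w) (k : ℕ) :
    ‖T (k * h) x - (hT.eulerStep hz ^ k) x‖
      ≤ k * (2 * M ^ 3 * h ^ 2 * Real.exp (2 * (ω * h)) ^ k * ‖w‖) := by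
  have hM := hT.nonneg
  set V := hT.eulerStep hz with hV
  have hTm : ∀ m : ℕ, ‖T h ^ m‖ ≤ M * Real.exp (2 * (ω * h)) ^ m := by
    intro m
    rw [← hT.1.map_nat_mul hh.le]
    refine (hT.norm_le _ (by positivity)).trans ?_
    rw [← Real.exp_nat_mul]
    have : 0 ≤ (m : ℝ) * (ω * h) := by positivity
    refine mul_le_mul_of_nonneg_left (Real.exp_le_exp.2 ?_) hM
    linarith
  -- Telescoping: T(h)^k - V^k = (∑ T(h)^i V^{k-1-i})(T(h) - V). In M³, two factors come from the
  -- powers and one from the local error.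
  have hsum := (hT.eulerStep_commute hz hh.le).geom_sum₂_mul k
  rw [hT.1.map_nat_mul hh.le, ← sub_apply, ← hsum, mul_apply_eq_comp]
  rw [sum_apply]
  refine (norm_sum_le_of_le (f := fun i => (T h ^ i * V ^ (k - 1 - i)) ((T h - V) x)) _
    (n := fun _ => 2 * M ^ 3 * h ^ 2 * Real.exp (2 * (ω * h)) ^ k * ‖w‖)
    fun i hi => ?_).trans_eq (by simp)
  have hi' : i < k := Finset.mem_range.1 hi
  set e := Real.exp (2 * (ω * h)) with he
  calc _ ≤ ‖T h ^ i‖ * ‖V ^ (k - 1 - i)‖ * ‖(T h - V) x‖ :=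
        ContinuousLinearMap.le_of_opNorm_le _ (norm_mul_le _ _) _
    _ ≤ (M * e ^ i) * (M * e ^ (k - 1 - i)) * (2 * M * h ^ 2 * e * ‖w‖) := by
        gcongr
        · exact hTm i
        · exact hT.norm_eulerStep_pow_le hz hh hω hu _
        · exact hT.norm_apply_sub_eulerStep_le hz hh hω hu hxy hyw
    _ = 2 * M ^ 3 * h ^ 2 * (e ^ i * e ^ (k - 1 - i) * e) * ‖w‖ := by ring
    _ = _ := by
        rw [← pow_add, ← pow_succ]
        congr 4
        omega

end step

/-- The exponential formula `T(t) x = lim (I - (t/k) A)^{-k} x` on the domain of `A²`, with a rate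
of convergence. -/
theorem IsC0SemigroupOfType.exponential_formula (hT : IsC0SemigroupOfType M ω T) (hω : 0 ≤ ω)
    {t : ℝ} (ht : 0 < t) {k : ℕ} (hk : 0 < k) (hkt : 2 * (ω * (t / k)) ≤ 1)
    (hz : ω < (((t / k)⁻¹ : ℝ) : ℂ).re) {x y w : E} (hxy : GenPair T x y)
    (hyw : GenPair T y w) :
    ‖T t x - (hT.eulerStep hz ^ k) x‖ ≤ 2 * M ^ 3 * t ^ 2 * Real.exp (2 * (ω * t)) * ‖w‖ / k := by
  have hk' : (0 : ℝ) < k := Nat.cast_pos.2 hk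
  have h := hT.norm_apply_sub_eulerStep_pow_le hz (by positivity) hω hkt hxy hyw k
  have h1 : (k : ℝ) * (t / k) = t := by field_simp
  rw [h1, ← Real.exp_nat_mul] at h
  have h2 : (k : ℝ) * (2 * (ω * (t / k))) = 2 * (ω * t) := by field_simp
  rw [h2] at h
  refine h.trans_eq ?_
  field_simp

end Euler

/-! ### Strong limits of bounded sequences and Neumann series -/

section StrongLimits

variable {E : Type*} [NormedAddCommGroup E] [NormedSpace ℂ E]

theorem tendsto_apply_of_norm_le {U : ℕ → E →L[ℂ] E} {C : ℝ} (hU : ∀ n, ‖U n‖ ≤ C) {V : E}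
    {x : ℕ → E} {y : E} (hx : Tendsto x atTop (𝓝 y))
    (hV : Tendsto (fun n => U n y) atTop (𝓝 V)) : Tendsto (fun n => U n (x n)) atTop (𝓝 V) := by
  have h1 : Tendsto (fun n => U n (x n - y)) atTop (𝓝 0) := by
    refine squeeze_zero_norm (fun n => (U n).le_of_opNorm_le (hU n) _) ?_
    simpa using (hx.sub_const y).norm.const_mul C
  simpa using h1.add hV

theorem tendsto_pow_apply_of_norm_le {U : ℕ → E →L[ℂ] E} {C : ℝ} (hU : ∀ n, ‖U n‖ ≤ C)
    {V : E →L[ℂ] E} (hV : ∀ x, Tendsto (fun n => U n x) atTop (𝓝 (V x))) (m : ℕ) (x : E) :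
    Tendsto (fun n => (U n ^ m) x) atTop (𝓝 ((V ^ m) x)) := by
  induction m with
  | zero => simp
  | succ m ih =>
    simp only [pow_succ', mul_apply_eq_comp]
    exact tendsto_apply_of_norm_le hU ih (hV _)

theorem norm_le_of_tendsto_apply {U : ℕ → E →L[ℂ] E} {C : ℝ} (hU : ∀ n, ‖U n‖ ≤ C)
    {V : E →L[ℂ] E} (hV : ∀ x, Tendsto (fun n => U n x) atTop (𝓝 (V x))) : ‖V‖ ≤ C := by
  refine ContinuousLinearMap.opNorm_le_bound _ ((norm_nonneg _).trans (hU 0)) fun x => ?_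
  exact le_of_tendsto (hV x).norm (Eventually.of_forall fun n => (U n).le_of_opNorm_le (hU n) x)

/-- The approximating sequence may depend on ε; below this allows the number of Euler steps to
depend on ε. -/
theorem cauchySeq_of_approx {F : Type*} [SeminormedAddCommGroup F] {u : ℕ → F}
    (h : ∀ ε > 0, ∃ v : ℕ → F, CauchySeq v ∧ ∀ᶠ n in atTop, ‖u n - v n‖ ≤ ε) : CauchySeq u := by
  rw [Metric.cauchySeq_iff']
  intro ε hε
  obtain ⟨v, hv, huv⟩ := h (ε / 4) (by linarith)
  obtain ⟨N₁, hN₁⟩ := eventually_atTop.1 huv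
  obtain ⟨N₂, hN₂⟩ := Metric.cauchySeq_iff.1 hv (ε / 4) (by linarith)
  refine ⟨max N₁ N₂, fun n hn => ?_⟩
  have h1 := hN₁ n ((le_max_left _ _).trans hn)
  have h2 := hN₁ (max N₁ N₂) (le_max_left _ _)
  have h3 := hN₂ n ((le_max_right _ _).trans hn) (max N₁ N₂) (le_max_right _ _)
  rw [← dist_eq_norm] at h1 h2
  have h4 := dist_triangle4 (u n) (v n) (v (max N₁ N₂)) (u (max N₁ N₂))
  rw [dist_comm (v _) (u _)] at h4
  linarith

theorem cauchySeq_apply_of_dense {U : ℕ → E →L[ℂ] E} {C : ℝ} (hU : ∀ n, ‖U n‖ ≤ C) {D : Set E}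
    (hD : Dense D) (h : ∀ x ∈ D, CauchySeq fun n => U n x) (x : E) :
    CauchySeq fun n => U n x := by
  have hC : 0 ≤ C := (norm_nonneg _).trans (hU 0)
  refine cauchySeq_of_approx fun ε hε => ?_
  obtain ⟨y, hy, hxy⟩ := hD.exists_dist_lt x (show 0 < ε / (C + 1) by positivity)
  refine ⟨fun n => U n y, h y hy, Eventually.of_forall fun n => ?_⟩
  rw [← map_sub]
  refine ((U n).le_of_opNorm_le (hU n) _).trans ?_
  rw [dist_eq_norm, lt_div_iff₀ (by positivity)] at hxy
  nlinarith [norm_nonneg (x - y)]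

theorem exists_clm_of_cauchySeq [CompleteSpace E] {U : ℕ → E →L[ℂ] E}
    (h : ∀ x, CauchySeq fun n => U n x) :
    ∃ V : E →L[ℂ] E, ∀ x, Tendsto (fun n => U n x) atTop (𝓝 (V x)) := by
  choose f hf using fun x => cauchySeq_tendsto_of_complete (h x)
  exact ⟨continuousLinearMapOfTendsto U (tendsto_pi_nhds.2 hf), hf⟩

/-- Iterating S = R + cRS leaves the remainder c^k R^k S. Bounds on powers of R, rather than on ‖R‖
alone, give convergence for |c| < r and not merely |c| < r/M. -/
theorem hasSum_neumann {R S : E →L[ℂ] E} {M r : ℝ} {c : ℂ} (hRS : S = R + c • (R * S))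
    (hr : 0 < r) (hR : ∀ m, ‖R ^ m‖ ≤ M / r ^ m) (hc : ‖c‖ < r) (x : E) [CompleteSpace E] :
    HasSum (fun m : ℕ => c ^ m • (R ^ (m + 1)) x) (S x) := by
  have hq : ‖c‖ / r < 1 := (div_lt_one hr).2 hc
  have hq0 : 0 ≤ ‖c‖ / r := by positivity
  have hbound : ∀ (m : ℕ) (v : E), ‖c ^ m • (R ^ m) v‖ ≤ M * ‖v‖ * (‖c‖ / r) ^ m := by
    intro m v
    rw [norm_smul, norm_pow, div_pow]
    calc _ ≤ ‖c‖ ^ m * (M / r ^ m * ‖v‖) := by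
          gcongr
          exact (R ^ m).le_of_opNorm_le (hR m) v
      _ = _ := by ring
  have hpart : ∀ k : ℕ, S x = ∑ m ∈ Finset.range k, c ^ m • (R ^ (m + 1)) x
      + c ^ k • (R ^ k) (S x) := by
    intro k
    induction k with
    | zero => simp
    | succ k ih =>
      rw [Finset.sum_range_succ, add_assoc]
      refine ih.trans ?_
      congr 1
      have : S x = R x + c • R (S x) := by
        conv_lhs => rw [hRS]
        rfl
      conv_lhs => rw [this]
      rw [map_add, map_smul, smul_add, smul_smul, ← pow_succ, pow_succ R k]
      rfl
  have hsum : Summable (fun m : ℕ => c ^ m • (R ^ (m + 1)) x) := by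
    refine Summable.of_norm_bounded ((summable_geometric_of_lt_one hq0 hq).mul_left
      (M * ‖R x‖)) fun m => ?_
    have := hbound m (R x)
    rwa [← mul_apply_eq_comp, ← pow_succ] at this
  have hrem : Tendsto (fun k => c ^ k • (R ^ k) (S x)) atTop (𝓝 0) := by
    refine squeeze_zero_norm (fun k => hbound k (S x)) ?_
    simpa using (tendsto_pow_atTop_nhds_zero_of_lt_one hq0 hq).const_mul (M * ‖S x‖)
  have hlim : Tendsto (fun k => ∑ m ∈ Finset.range k, c ^ m • (R ^ (m + 1)) x) atTop
      (𝓝 (S x)) := by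
    have := (tendsto_const_nhds (x := S x)).sub hrem
    rw [sub_zero] at this
    refine this.congr fun k => ?_
    rw [sub_eq_iff_eq_add]
    exact hpart k
  rw [hsum.hasSum_iff_tendsto_nat]
  exact hlim

/-- Each term converges strongly and a geometric series dominates uniformly in n, so limit and sum
can be exchanged. -/
theorem cauchySeq_neumann [CompleteSpace E] {R S : ℕ → E →L[ℂ] E} {M r : ℝ} {c : ℂ}
    (hRS : ∀ n, S n = R n + c • (R n * S n)) (hr : 0 < r)
    (hR : ∀ n m, ‖R n ^ m‖ ≤ M / r ^ m) (hc : ‖c‖ < r) {V : E →L[ℂ] E}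
    (hV : ∀ x, Tendsto (fun n => R n x) atTop (𝓝 (V x))) (x : E) :
    CauchySeq fun n => S n x := by
  have hq : ‖c‖ / r < 1 := (div_lt_one hr).2 hc
  have hq0 : 0 ≤ ‖c‖ / r := by positivity
  have hR1 : ∀ n, ‖R n‖ ≤ M / r := fun n => by simpa using hR n 1
  have key : Tendsto (fun n => ∑' m : ℕ, c ^ m • (R n ^ (m + 1)) x) atTop
      (𝓝 (∑' m : ℕ, c ^ m • (V ^ (m + 1)) x)) := by
    refine tendsto_tsum_of_dominated_convergence
      (bound := fun m => M / r * ‖x‖ * (‖c‖ / r) ^ m)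
      ((summable_geometric_of_lt_one hq0 hq).mul_left _) (fun m => ?_)
      (Eventually.of_forall fun n m => ?_)
    · exact (tendsto_pow_apply_of_norm_le hR1 hV (m + 1) x).const_smul _
    · rw [norm_smul, norm_pow]
      calc _ ≤ ‖c‖ ^ m * (M / r ^ (m + 1) * ‖x‖) := by
            gcongr
            exact (R n ^ (m + 1)).le_of_opNorm_le (hR n (m + 1)) x
        _ = _ := by
          rw [div_pow]
          field_simp
          ring
  refine (key.congr fun n => ?_).cauchySeq
  exact (hasSum_neumann (hRS n) hr (hR n) hc x).tsum_eq

end StrongLimits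

/-! ### Spreading convergence over the half plane -/

section Resolvents

variable {E : Type*} [NormedAddCommGroup E] [NormedSpace ℂ E] [CompleteSpace E] {M ω : ℝ}

/-- Apply the resolvent at w to (w - A)R(z)x = x + (w - z)R(z)x. -/
theorem IsC0SemigroupOfType.resolvent_identity {T : ℝ → E →L[ℂ] E}
    (hT : IsC0SemigroupOfType M ω T) {z w : ℂ} (hz : ω < z.re) (hw : ω < w.re) :
    hT.laplace hz = hT.laplace hw + (w - z) • (hT.laplace hw * hT.laplace hz) := by
  ext x
  have h := hT.laplace_of_genPair hw (hT.genPair_laplace hz x)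
  rw [← sub_add, ← sub_smul, map_add, map_smul] at h
  rw [add_comm]
  exact h.symm

/-- Strong convergence of resolvents at one point of a half plane implies strong convergence at
all points of it. -/
theorem exists_tendsto_laplace {T : ℕ → ℝ → E →L[ℂ] E}
    (hT : ∀ n, IsC0SemigroupOfType M ω (T n)) {z₀ : ℂ} (hz₀ : ω < z₀.re) {R₀ : E →L[ℂ] E}
    (h₀ : ∀ x, Tendsto (fun n => (hT n).laplace hz₀ x) atTop (𝓝 (R₀ x))) {z : ℂ}
    (hz : ω < z.re) :
    ∃ V : E →L[ℂ] E, ∀ x, Tendsto (fun n => (hT n).laplace hz x) atTop (𝓝 (V x)) := by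
  let H : Set ℂ := {z | ω < z.re}
  let P : Set ℂ := {z | ∃ hz : ω < z.re, ∃ V : E →L[ℂ] E,
    ∀ x, Tendsto (fun n => (hT n).laplace hz x) atTop (𝓝 (V x))}
  have hstep : ∀ w ∈ P, ∀ z : ℂ, ω < z.re → ‖w - z‖ < w.re - ω → z ∈ P := by
    rintro w ⟨hw, V, hV⟩ z hz hwz
    exact ⟨hz, exists_clm_of_cauchySeq fun x => cauchySeq_neumann
      (fun n => (hT n).resolvent_identity hz hw) (sub_pos.2 hw)
      (fun n m => (hT n).norm_laplace_pow_le hw m) hwz hV x⟩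
  have hre : ∀ w z : ℂ, z.re - w.re ≤ ‖w - z‖ := fun w z => by
    rw [← Complex.sub_re, norm_sub_rev]
    exact Complex.re_le_norm _
  have hH : IsPreconnected H := (convex_halfSpace_re_gt ω).isPreconnected
  have hPopen : IsOpen P := by
    rw [Metric.isOpen_iff]
    intro w hw
    have hw' : 0 < w.re - ω := sub_pos.2 hw.1
    refine ⟨w.re - ω, hw', fun z hz => ?_⟩
    rw [Metric.mem_ball, dist_comm, dist_eq_norm] at hz
    have := hre z w
    rw [norm_sub_rev] at this
    exact hstep w hw z (by linarith) hz
  have hclosed : closure P ∩ H ⊆ P := by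
    rintro z ⟨hzP, hz⟩
    have hz : ω < z.re := hz
    -- Such a w satisfies Re w - ω > (Re z - ω)/2, so its disc of convergence contains z.
    obtain ⟨w, hw, hwz⟩ := Metric.mem_closure_iff.1 hzP ((z.re - ω) / 2) (by linarith)
    rw [dist_comm, dist_eq_norm] at hwz
    have := hre w z
    exact hstep w hw z hz (by linarith)
  exact (hH.subset_of_closure_inter_subset hPopen ⟨z₀, hz₀, hz₀, R₀, h₀⟩ hclosed hz).2

end Resolvents

/-! ### Convergence of the semigroups and uniqueness -/

section Convergence

variable {E : Type*} [NormedAddCommGroup E] [NormedSpace ℂ E]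

theorem GenPair.sub {T : ℝ → E →L[ℂ] E} {x y x' y' : E} (h : GenPair T x y)
    (h' : GenPair T x' y') : GenPair T (x - x') (y - y') := by
  have := h.add (h'.smul (-1))
  simpa [sub_eq_add_neg] using this

theorem tendstoUniformlyOn_of_equiLipschitz {F : Type*} [SeminormedAddCommGroup F]
    {f : ℕ → ℝ → F} {g : ℝ → F} {b L : ℝ}
    (hf : ∀ n, ∀ s ∈ Icc 0 b, ∀ t ∈ Icc 0 b, ‖f n t - f n s‖ ≤ L * |t - s|)
    (hg : ∀ t ∈ Icc 0 b, Tendsto (fun n => f n t) atTop (𝓝 (g t))) :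
    TendstoUniformlyOn f g atTop (Icc 0 b) := by
  have hgL : ∀ s ∈ Icc 0 b, ∀ t ∈ Icc 0 b, ‖g t - g s‖ ≤ L * |t - s| := fun s hs t ht =>
    le_of_tendsto ((hg t ht).sub (hg s hs)).norm (Eventually.of_forall fun n => hf n s hs t ht)
  rw [← tendstoLocallyUniformlyOn_iff_tendstoUniformlyOn_of_compact isCompact_Icc,
    Metric.tendstoLocallyUniformlyOn_iff]
  intro ε hε s hs
  have hcont : Tendsto (fun t => L * |t - s|) (𝓝[Icc 0 b] s) (𝓝 0) := by
    refine Tendsto.mono_left ?_ nhdsWithin_le_nhds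
    have : Continuous fun t : ℝ => L * |t - s| := by fun_prop
    simpa using this.tendsto s
  refine ⟨_, inter_mem self_mem_nhdsWithin (hcont.eventually_lt_const (show 0 < ε / 3 by
    linarith)), ?_⟩
  filter_upwards [Metric.tendsto_nhds.1 (hg s hs) (ε / 3) (by linarith)] with n hn t ht
  have h1 := hgL s hs t ht.1
  have h2 := hf n s hs t ht.1
  have h3 : L * |t - s| < ε / 3 := ht.2
  rw [← dist_eq_norm] at h1 h2
  have h4 := dist_triangle4 (g t) (g s) (f n s) (f n t)
  rw [dist_comm (g s), dist_comm (f n s) (f n t)] at h4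
  linarith

theorem tendsto_laplace_apply {M ω : ℝ} {T : ℕ → ℝ → E →L[ℂ] E} {S : ℝ → E →L[ℂ] E}
    (hT : ∀ n, IsC0SemigroupOfType M ω (T n)) (hS : IsC0SemigroupOfType M ω S)
    (h : ∀ t, 0 ≤ t → ∀ x, Tendsto (fun n => T n t x) atTop (𝓝 (S t x))) {z : ℂ}
    (hz : ω < z.re) (x : E) :
    Tendsto (fun n => (hT n).laplace hz x) atTop (𝓝 (hS.laplace hz x)) := by
  refine tendsto_integral_of_dominated_convergence
    (fun t => M * ‖x‖ * Real.exp ((ω - z.re) * t)) (fun n => ((hT n).integrableOn hz x).1)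
    ((integrableOn_exp_mul_Ioi (by linarith) 0).const_mul _) (fun n => ?_) ?_
  · filter_upwards [ae_restrict_mem measurableSet_Ioi] with t ht
    exact (hT n).norm_exp_smul_le z (le_of_lt ht) x
  · filter_upwards [ae_restrict_mem measurableSet_Ioi] with t ht
    exact (h t (le_of_lt ht) x).const_smul _

variable [CompleteSpace E] {M ω : ℝ}

theorem cauchySeq_semigroup_apply (hω : 0 ≤ ω) {T : ℕ → ℝ → E →L[ℂ] E}
    (hT : ∀ n, IsC0SemigroupOfType M ω (T n)) {z₀ : ℂ} (hz₀ : ω < z₀.re) {R₀ : E →L[ℂ] E}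
    (h₀ : ∀ x, Tendsto (fun n => (hT n).laplace hz₀ x) atTop (𝓝 (R₀ x)))
    (hdense : DenseRange R₀) {t : ℝ} (ht : 0 ≤ t) (x : E) : CauchySeq fun n => T n t x := by
  rcases ht.eq_or_lt with rfl | ht'
  · simp only [(hT _).1.map_zero]
    exact cauchySeq_const _
  have hTn : ∀ n, ‖T n t‖ ≤ M * Real.exp (ω * t) := fun n => (hT n).norm_le t ht
  have hM := (hT 0).nonneg
  have hL : ∀ n, ‖(hT n).laplace hz₀‖ ≤ M / (z₀.re - ω) := fun n => by
    simpa using (hT n).norm_laplace_pow_le hz₀ 1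
  -- R₀² still has dense range, and two resolvents are needed to land in D(A_n²).
  refine cauchySeq_apply_of_dense hTn (hdense.comp hdense R₀.continuous) ?_ x
  rintro _ ⟨w, rfl⟩
  simp only [Function.comp_apply]
  set L := fun n => (hT n).laplace hz₀ with hLdef
  have hLL : Tendsto (fun n => L n (L n w)) atTop (𝓝 (R₀ (R₀ w))) :=
    tendsto_apply_of_norm_le hL (h₀ w) (h₀ _)
  have hgen : ∀ n, GenPair (T n) (L n (L n w)) (z₀ • L n (L n w) - L n w) := fun n =>
    (hT n).genPair_laplace hz₀ _
  have hgen2 : ∀ n, GenPair (T n) (z₀ • L n (L n w) - L n w)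
      (z₀ • (z₀ • L n (L n w) - L n w) - (z₀ • L n w - w)) := fun n =>
    ((hgen n).smul z₀).sub ((hT n).genPair_laplace hz₀ w)
  obtain ⟨W, hW⟩ := ((((hLL.const_smul z₀).sub (h₀ w)).const_smul z₀).sub
    (((h₀ w).const_smul z₀).sub_const w)).norm.bddAbove_range
  have hW : ∀ n, ‖z₀ • (z₀ • L n (L n w) - L n w) - (z₀ • L n w - w)‖ ≤ W := fun n =>
    hW ⟨n, rfl⟩
  refine cauchySeq_of_approx fun ε hε => ?_
  set C := 2 * M ^ 3 * t ^ 2 * Real.exp (2 * (ω * t)) * W with hC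
  have hk : ∀ᶠ k : ℕ in atTop, 0 < k ∧ 2 * (ω * (t / k)) ≤ 1 ∧ C / k ≤ ε / 2 := by
    refine (eventually_gt_atTop 0).and (Eventually.and ?_ ?_)
    · have : Tendsto (fun k : ℕ => 2 * (ω * (t / k))) atTop (𝓝 0) := by
        simpa using ((tendsto_const_div_atTop_nhds_zero_nat t).const_mul ω).const_mul 2
      exact this.eventually_le_const one_pos
    · exact (tendsto_const_div_atTop_nhds_zero_nat C).eventually_le_const (by linarith)
  -- W bounds A_n²L_n²w for all n, so one k serves every n: half of ε goes to the Euler error, half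
  -- to replacing R₀²w by L_n²w.
  obtain ⟨k, hk0, hkt, hkC⟩ := hk.exists
  have hk' : (0 : ℝ) < k := Nat.cast_pos.2 hk0
  have hz : ω < (((t / k)⁻¹ : ℝ) : ℂ).re := lt_ofReal_inv_re (by positivity) hkt
  obtain ⟨V, hV⟩ := exists_tendsto_laplace hT hz₀ h₀ hz
  have hstep : ∀ v, Tendsto (fun n => (hT n).eulerStep hz v) atTop
      (𝓝 (((((t / k)⁻¹ : ℝ) : ℂ) • V) v)) := fun v => (hV v).const_smul _
  have hstep1 : ∀ n, ‖(hT n).eulerStep hz‖ ≤ M * Real.exp (2 * (ω * (t / k))) := fun n => by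
    simpa using (hT n).norm_eulerStep_pow_le hz (by positivity) hω hkt 1
  refine ⟨fun n => ((hT n).eulerStep hz ^ k) (L n (L n w)), ?_, ?_⟩
  · exact (tendsto_apply_of_norm_le
      (fun n => (hT n).norm_eulerStep_pow_le hz (by positivity) hω hkt k) hLL
      (tendsto_pow_apply_of_norm_le hstep1 hstep k _)).cauchySeq
  · have h1 : Tendsto (fun n => M * Real.exp (ω * t) * ‖R₀ (R₀ w) - L n (L n w)‖) atTop
        (𝓝 0) := by
      simpa using (hLL.const_sub (R₀ (R₀ w))).norm.const_mul (M * Real.exp (ω * t))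
    filter_upwards [h1.eventually_le_const (show 0 < ε / 2 by linarith)] with n hn
    have h2 := (hT n).norm_apply_le ht (R₀ (R₀ w) - L n (L n w))
    have h3 := (hT n).exponential_formula hω ht' hk0 hkt hz (hgen n) (hgen2 n)
    rw [map_sub] at h2
    have h4 : 2 * M ^ 3 * t ^ 2 * Real.exp (2 * (ω * t)) *
        ‖z₀ • (z₀ • L n (L n w) - L n w) - (z₀ • L n w - w)‖ / k ≤ C / k := by
      rw [hC]
      gcongr
      exact hW n
    have h5 := norm_sub_le_norm_sub_add_norm_sub (T n t (R₀ (R₀ w))) (T n t (L n (L n w)))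
      (((hT n).eulerStep hz ^ k) (L n (L n w)))
    linarith

/-- R₀w is the limit of u_n = R(z₀; A_n)w, and A_n u_n = z₀u_n - w is bounded. Hence the orbits of
u_n are Lipschitz on [0, b] uniformly in n, and density of the range does the rest. -/
theorem tendstoUniformlyOn_semigroup (hω : 0 ≤ ω) {T : ℕ → ℝ → E →L[ℂ] E}
    (hT : ∀ n, IsC0SemigroupOfType M ω (T n)) {z₀ : ℂ} (hz₀ : ω < z₀.re) {R₀ : E →L[ℂ] E}
    (h₀ : ∀ x, Tendsto (fun n => (hT n).laplace hz₀ x) atTop (𝓝 (R₀ x)))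
    (hdense : DenseRange R₀) {S : ℝ → E →L[ℂ] E}
    (hS : ∀ t, 0 ≤ t → ∀ x, Tendsto (fun n => T n t x) atTop (𝓝 (S t x))) (b : ℝ) (x : E) :
    TendstoUniformlyOn (fun n t => T n t x) (fun t => S t x) atTop (Icc 0 b) := by
  have hM := (hT 0).nonneg
  set K := M * Real.exp (ω * b) with hK
  have hK0 : 0 ≤ K := by positivity
  have hTK : ∀ n, ∀ t ∈ Icc 0 b, ‖T n t‖ ≤ K := fun n t ht => by
    refine ((hT n).norm_le t ht.1).trans ?_
    have := ht.2
    rw [hK]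
    gcongr
  have hSK : ∀ t ∈ Icc 0 b, ‖S t‖ ≤ K := fun t ht =>
    norm_le_of_tendsto_apply (fun n => hTK n t ht) (hS t ht.1)
  rw [Metric.tendstoUniformlyOn_iff]
  intro ε hε
  -- Four errors of ε/4: x against R₀w under S and under T_n, u_n against R₀w, and the uniform
  -- convergence of T_n(t)u_n. K + 1 avoids dividing by zero.
  obtain ⟨_, ⟨w, rfl⟩, hw⟩ := Dense.exists_dist_lt hdense x (show 0 < ε / (4 * (K + 1)) by
    positivity)
  set u := fun n => (hT n).laplace hz₀ w with hu
  have hgen : ∀ n, GenPair (T n) (u n) (z₀ • u n - w) := fun n => (hT n).genPair_laplace hz₀ w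
  obtain ⟨W, hW⟩ := (((h₀ w).const_smul z₀).sub_const w).norm.bddAbove_range
  have hW : ∀ n, ‖z₀ • u n - w‖ ≤ W := fun n => hW ⟨n, rfl⟩
  have hlip : ∀ n, ∀ s ∈ Icc 0 b, ∀ t ∈ Icc 0 b,
      ‖T n t (u n) - T n s (u n)‖ ≤ K * W * |t - s| := by
    intro n s hs t ht
    wlog hst : s ≤ t generalizing s t
    · rw [norm_sub_rev, abs_sub_comm]
      exact this t ht s hs (le_of_not_ge hst)
    rw [abs_of_nonneg (sub_nonneg.2 hst)]
    refine ((hT n).norm_sub_le_of_genPair hω (hgen n) hs.1 hst ht.2).trans ?_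
    have := hW n
    have : 0 ≤ t - s := sub_nonneg.2 hst
    gcongr
  have hunif := tendstoUniformlyOn_of_equiLipschitz hlip (g := fun t => S t (R₀ w))
    fun t ht => tendsto_apply_of_norm_le (fun n => hTK n t ht) (h₀ w) (hS t ht.1 _)
  have hconv : Tendsto (fun n => K * ‖u n - R₀ w‖) atTop (𝓝 0) := by
    simpa using (((h₀ w).sub_const (R₀ w)).norm.const_mul K)
  have hx : K * ‖x - R₀ w‖ < ε / 4 := by
    rw [dist_eq_norm, lt_div_iff₀ (by positivity)] at hw
    nlinarith [norm_nonneg (x - R₀ w)]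
  filter_upwards [Metric.tendstoUniformlyOn_iff.1 hunif (ε / 4) (by linarith),
    hconv.eventually_lt_const (show 0 < ε / 4 by linarith)] with n h1 h2 t ht
  have e1 := (S t).le_of_opNorm_le (hSK t ht) (x - R₀ w)
  have e2 := h1 t ht
  have e3 := (T n t).le_of_opNorm_le (hTK n t ht) (u n - R₀ w)
  have e4 := (T n t).le_of_opNorm_le (hTK n t ht) (x - R₀ w)
  rw [map_sub, ← dist_eq_norm] at e1 e3 e4
  have t1 := dist_triangle4 (S t x) (S t (R₀ w)) (T n t (u n)) (T n t (R₀ w))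
  have t2 := dist_triangle (S t x) (T n t (R₀ w)) (T n t x)
  rw [dist_comm (T n t (R₀ w)) (T n t x)] at t2
  linarith

/-- The semigroup law and the norm bound pass to pointwise strong limits; continuity at 0 is where
uniformity in t is used. -/
theorem exists_limit_semigroup (hω : 0 ≤ ω) {T : ℕ → ℝ → E →L[ℂ] E}
    (hT : ∀ n, IsC0SemigroupOfType M ω (T n)) {z₀ : ℂ} (hz₀ : ω < z₀.re) {R₀ : E →L[ℂ] E}
    (h₀ : ∀ x, Tendsto (fun n => (hT n).laplace hz₀ x) atTop (𝓝 (R₀ x)))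
    (hdense : DenseRange R₀) :
    ∃ S : ℝ → E →L[ℂ] E, IsC0SemigroupOfType M ω S ∧
      (∀ t, 0 ≤ t → ∀ x, Tendsto (fun n => T n t x) atTop (𝓝 (S t x))) ∧
      ∀ b x, TendstoUniformlyOn (fun n t => T n t x) (fun t => S t x) atTop (Icc 0 b) := by
  have hex : ∀ t : ℝ, ∃ V : E →L[ℂ] E, 0 ≤ t →
      ∀ x, Tendsto (fun n => T n t x) atTop (𝓝 (V x)) := fun t => by
    by_cases ht : 0 ≤ t
    · obtain ⟨V, hV⟩ := exists_clm_of_cauchySeq fun x =>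
        cauchySeq_semigroup_apply hω hT hz₀ h₀ hdense ht x
      exact ⟨V, fun _ => hV⟩
    · exact ⟨0, fun h => absurd h ht⟩
  choose S hS using hex
  have hunif := tendstoUniformlyOn_semigroup hω hT hz₀ h₀ hdense hS
  have hzero : S 0 = ContinuousLinearMap.id ℂ E := by
    ext x
    refine tendsto_nhds_unique (hS 0 le_rfl x) ?_
    simp [(hT _).1.map_zero]
  refine ⟨S, ⟨⟨hzero, fun t s ht hs => ?_, fun x => ?_⟩, fun t ht => ?_⟩, hS, hunif⟩
  · ext x
    refine tendsto_nhds_unique (hS _ (add_nonneg ht hs) x) ?_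
    simp only [(hT _).1.map_add_apply ht hs]
    exact tendsto_apply_of_norm_le (fun n => (hT n).norm_le t ht) (hS s hs x) (hS t ht _)
  · have hc : ContinuousOn (fun t => S t x) (Icc 0 1) :=
      (hunif 1 x).continuousOn (Eventually.of_forall fun n =>
        ((hT n).continuousOn x).mono fun r hr => hr.1).frequently
    have := (hc 0 ⟨le_rfl, zero_le_one⟩).tendsto.mono_left
      (nhdsWithin_le_of_mem (Icc_mem_nhdsGT (zero_lt_one (α := ℝ))))
    simpa [hzero] using this
  · exact norm_le_of_tendsto_apply (fun n => (hT n).norm_le t ht) (hS t ht)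

theorem IsC0SemigroupOfType.mem_range_laplace_iff {T : ℝ → E →L[ℂ] E}
    (hT : IsC0SemigroupOfType M ω T) {z : ℂ} (hz : ω < z.re) {x : E} :
    x ∈ range (hT.laplace hz) ↔ ∃ y, GenPair T x y :=
  ⟨by rintro ⟨y, rfl⟩; exact ⟨_, hT.genPair_laplace hz y⟩,
    fun ⟨_, h⟩ => ⟨_, hT.laplace_of_genPair hz h⟩⟩

/-- A `C₀`-semigroup is determined by its densely defined generator. -/
theorem IsC0Semigroup.eq_of_isInfinitesimalGenerator {T S : ℝ → E →L[ℂ] E}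
    (hT : IsC0Semigroup T) (hS : IsC0Semigroup S) {A : E →ₗ.[ℂ] E}
    (hAT : IsInfinitesimalGenerator A T) (hAS : IsInfinitesimalGenerator A S)
    (hA : Dense (A.domain : Set E)) {t : ℝ} (ht : 0 ≤ t) : T t = S t := by
  obtain ⟨M₁, ω₁, hω₁, hT₁⟩ := hT.exists_type
  obtain ⟨M₂, ω₂, -, hS₂⟩ := hS.exists_type
  have hT' := hT₁.mono (le_max_left M₁ M₂) (le_max_left ω₁ ω₂)
  have hS' := hS₂.mono (le_max_right M₁ M₂) (le_max_right ω₁ ω₂)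
  set ω := max ω₁ ω₂ with hω
  have hω0 : 0 ≤ ω := hω₁.trans (le_max_left _ _)
  have hz : ω < ((ω + 1 : ℝ) : ℂ).re := by simp
  -- Interleave T and S. The common generator makes the resolvents constant in n, so the convergence
  -- result shows that T t x, S t x, T t x, … is Cauchy, hence constant.
  set U : ℕ → ℝ → E →L[ℂ] E := fun n => if Even n then T else S with hU
  have hUtype : ∀ n, IsC0SemigroupOfType (max M₁ M₂) ω (U n) := fun n => by
    by_cases hn : Even n
    · simpa [hU, hn] using hT'
    · simpa [hU, hn] using hS'
  have hUA : ∀ n, IsInfinitesimalGenerator A (U n) := fun n => by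
    by_cases hn : Even n
    · simpa [hU, hn] using hAT
    · simpa [hU, hn] using hAS
  have hlap : ∀ n, (hUtype n).laplace hz = hT'.laplace hz := fun n =>
    ((hUtype n).isResolventAt_laplace hz (hUA n)).unique (hT'.isResolventAt_laplace hz hAT)
  have hdense : DenseRange (hT'.laplace hz) := by
    refine hA.mono fun x hx => ?_
    exact (hT'.mem_range_laplace_iff hz).2 ((hAT.mem_domain_iff x).1 hx)
  ext x
  have hc := cauchySeq_semigroup_apply hω0 hUtype hz (R₀ := hT'.laplace hz)
    (fun x => by simp only [hlap]; exact tendsto_const_nhds) hdense ht x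
  refine eq_of_forall_dist_le fun ε hε => ?_
  obtain ⟨N, hN⟩ := Metric.cauchySeq_iff.1 hc ε hε
  have := hN (2 * N) (by omega) (2 * N + 1) (by omega)
  simpa [hU] using this.le

end Convergence

end

/-! ### The Trotter–Kato theorem -/

theorem mainTheorem5 {E : Type*} [NormedAddCommGroup E] [NormedSpace ℂ E] [CompleteSpace E]
    (M ω : ℝ) (hM : 1 ≤ M) (hω : 0 ≤ ω)
    (T : ℕ → ℝ → E →L[ℂ] E) (A : ℕ → E →ₗ.[ℂ] E)
    (hT : ∀ n, IsC0SemigroupOfType M ω (T n))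
    (hA : ∀ n, IsInfinitesimalGenerator (A n) (T n))
    (z₀ : ℂ) (hz₀ : ω < z₀.re) (R₀ : E →L[ℂ] E)
    (hconv : ∀ x : E, Tendsto (fun n => (A n).resolventOp z₀ x) atTop (𝓝 (R₀ x)))
    (hdense : DenseRange R₀) :
    ∃ R : ℂ → E →L[ℂ] E, R z₀ = R₀ ∧
      (∀ z : ℂ, ω < z.re →
        ∀ x : E, Tendsto (fun n => (A n).resolventOp z x) atTop (𝓝 (R z x))) ∧
      (∃! B : E →ₗ.[ℂ] E, IsGeneratorOfType M ω B ∧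
        ∀ z : ℂ, ω < z.re → R z = B.resolventOp z) ∧
      (∀ B : E →ₗ.[ℂ] E, IsGeneratorOfType M ω B →
        (∀ z : ℂ, ω < z.re → R z = B.resolventOp z) →
        ∀ S : ℝ → E →L[ℂ] E, IsC0Semigroup S → IsInfinitesimalGenerator B S →
          ∀ t₀ : ℝ, 0 < t₀ → ∀ x : E,
            TendstoUniformlyOn (fun n t => T n t x) (fun t => S t x) atTop (Set.Icc 0 t₀)) := by
  have hres : ∀ n z (hz : ω < z.re), (A n).resolventOp z = (hT n).laplace hz := fun n z hz =>
    ((hT n).isResolventAt_laplace hz (hA n)).resolventOp_eq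
  simp only [hres _ z₀ hz₀] at hconv
  obtain ⟨S, hS, hlim, hunif⟩ := exists_limit_semigroup hω hT hz₀ hconv hdense
  obtain ⟨B, hB⟩ := exists_isInfinitesimalGenerator S
  have hBres : ∀ z (hz : ω < z.re), B.resolventOp z = hS.laplace hz := fun z hz =>
    (hS.isResolventAt_laplace hz hB).resolventOp_eq
  have hR₀ : hS.laplace hz₀ = R₀ := ContinuousLinearMap.ext fun x =>
    tendsto_nhds_unique (tendsto_laplace_apply hT hS hlim hz₀ x) (hconv x)
  have huniq : ∀ B' : E →ₗ.[ℂ] E, IsGeneratorOfType M ω B' →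
      (∀ z : ℂ, ω < z.re → B.resolventOp z = B'.resolventOp z) → B' = B := by
    intro B' hB' h
    have h1 := hB'.isResolventAt hz₀
    rw [← h z₀ hz₀, hBres z₀ hz₀] at h1
    exact h1.ext (hS.isResolventAt_laplace hz₀ hB)
  refine ⟨B.resolventOp, (hBres z₀ hz₀).trans hR₀, fun z hz x => ?_,
    ⟨B, ⟨hS.isGeneratorOfType hB, fun _ _ => rfl⟩, fun B' hB' => huniq B' hB'.1 hB'.2⟩,
    fun B' hB' h S' hS' hBS' t₀ _ x => ?_⟩
  · simp only [hres _ z hz, hBres z hz]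
    exact tendsto_laplace_apply hT hS hlim hz x
  · obtain rfl := huniq B' hB' h
    -- The domain is the range of the resolvent at z₀, which is R₀. Density lets the given semigroup
    -- S' be identified with the limit S.
    have hdom : Dense (B'.domain : Set E) := by
      refine Dense.mono (fun x hx => ?_) hdense
      rw [← hR₀, hS.mem_range_laplace_iff hz₀] at hx
      exact (hB.mem_domain_iff x).2 hx
    refine (hunif t₀ x).congr_right fun t ht => ?_
    simp only
    rw [hS.1.eq_of_isInfinitesimalGenerator hS' hB hBS' hdom ht.1]
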